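/- Let $N$ be a smooth $3$-dimensional Riemannian manifold with metric $g_N$, let $I\subseteq\mathbb{R}$ be an open interval and let $F:I\to(0,\infty)$ be smooth and not constant. Let $M=I\times N$ be the $4$-dimensional generalized Robertson--Walker (GRW) spacetime with the Lorentzian metric $g=-dt^2+F(t)^2g_N$, and let $\rho=\partial/\partial t$ be its unit timelike vector field. Suppose that $(M,g)$ admits a gradient Ricci soliton, that is, there are a smooth function $f:M\to\mathbb{R}$ and a real number $\lambda$ with $$\operatorname{Hess} f+S+\lambda g=0,$$ where $S$ is the Ricci tensor of $g$, and suppose that $\rho f$ is constant on $M$. Then $(M,g)$ is a Robertson--Walker spacetime, i.e. $(N,g_N)$ has constant sectional curvature. -/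

import Mathlib

set_option maxSynthPendingDepth 3

open scoped ContDiff Manifold

noncomputable section

/-! ### Levi-Civita calculus of a semi-Riemannian metric in an open set of a vector space -/

section LocalCalculus

variable {E : Type*} [NormedAddCommGroup E] [NormedSpace ℝ E]

/-- Christoffel symbols of the first kind of a metric `G` given on (an open set of) `E`:
`Γ(u, v; w) = (∂_u G(v, w) + ∂_v G(u, w) - ∂_w G(u, v)) / 2`. -/
def christoffelLower (G : E → E →L[ℝ] E →L[ℝ] ℝ) (y : E) : E →L[ℝ] E →L[ℝ] E →L[ℝ] ℝ :=
  let flip₂ : (E →L[ℝ] E →L[ℝ] ℝ) →L[ℝ] E →L[ℝ] E →L[ℝ] ℝ :=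
    (ContinuousLinearMap.flipₗᵢ ℝ E E ℝ).toContinuousLinearEquiv
  let D : E →L[ℝ] E →L[ℝ] E →L[ℝ] ℝ := fderiv ℝ G y
  (2⁻¹ : ℝ) • (D + D.flip - flip₂.comp D.flip)

theorem christoffelLower_apply (G : E → E →L[ℝ] E →L[ℝ] ℝ) (y u v w : E) :
    christoffelLower G y u v w =
      2⁻¹ * (fderiv ℝ G y u v w + fderiv ℝ G y v u w - fderiv ℝ G y w u v) := by
  simp [christoffelLower]

/-- Christoffel symbols of the second kind: `Γ(u, v)` is the vector that corresponds to the
covector `Γ(u, v; ·)` under `G y : E → E*`, which is invertible for a nondegenerate metric. -/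
def christoffel (G : E → E →L[ℝ] E →L[ℝ] ℝ) (y : E) : E →L[ℝ] E →L[ℝ] E :=
  (ContinuousLinearMap.compL ℝ E (E →L[ℝ] ℝ) E (G y).inverse).comp (christoffelLower G y)

theorem christoffel_apply (G : E → E →L[ℝ] E →L[ℝ] ℝ) (y u v : E) :
    christoffel G y u v = (G y).inverse (christoffelLower G y u v) := rfl

/-- The curvature tensor `R(u, v)w = ∂_u Γ(v, w) - ∂_v Γ(u, w) + Γ(u, Γ(v, w)) - Γ(v, Γ(u, w))`,
i.e. `R(U, V)W = ∇_U ∇_V W - ∇_V ∇_U W - ∇_[U, V] W`. -/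
def localCurvature (G : E → E →L[ℝ] E →L[ℝ] ℝ) (y u v w : E) : E :=
  fderiv ℝ (christoffel G) y u v w - fderiv ℝ (christoffel G) y v u w
    + christoffel G y u (christoffel G y v w) - christoffel G y v (christoffel G y u w)

/-- The Ricci tensor `Ric(v, w) = trace (u ↦ R(u, v)w)`. -/
def localRicci (G : E → E →L[ℝ] E →L[ℝ] ℝ) (y v w : E) : ℝ :=
  LinearMap.trace ℝ E
    { toFun := fun u => localCurvature G y u v w
      map_add' := fun a b => by simp only [localCurvature, map_add, add_apply]; abel
      map_smul' := fun c a => by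
        simp only [localCurvature, map_smul, smul_apply, RingHom.id_apply, smul_add, smul_sub] }

/-- The Hessian `∇²φ(u, v) = ∂_u ∂_v φ - dφ(Γ(u, v))` of a function `φ`. -/
def localHessian (G : E → E →L[ℝ] E →L[ℝ] ℝ) (φ : E → ℝ) (y u v : E) : ℝ :=
  fderiv ℝ (fderiv ℝ φ) y u v - fderiv ℝ φ y (christoffel G y u v)

end LocalCalculus

/-! ### The corresponding tensors on a manifold without boundary -/

section Manifolds

variable {E : Type*} [NormedAddCommGroup E] [NormedSpace ℝ E]
  {H : Type*} [TopologicalSpace H] (I : ModelWithCorners ℝ E H)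
  (M : Type*) [TopologicalSpace M] [ChartedSpace H M]

/-- Fields of bilinear forms on the tangent spaces of `M`. -/
abbrev MetricField : Type _ :=
  ∀ p : M, TangentSpace I p →L[ℝ] TangentSpace I p →L[ℝ] ℝ

variable {I M}

/-- The metric `g` written in the preferred chart `φ` at `p`:
`G_y(u, v) = g_{φ⁻¹ y}(dφ⁻¹ u, dφ⁻¹ v)`. -/
def MetricField.inChart (g : MetricField I M) (p : M) (y : E) : E →L[ℝ] E →L[ℝ] ℝ :=
  let A : E →L[ℝ] E := mfderiv 𝓘(ℝ, E) I (extChartAt I p).symm y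
  let B : E →L[ℝ] E →L[ℝ] ℝ := g ((extChartAt I p).symm y)
  B.bilinearComp A A

/-- The curvature tensor of `g` at `p`. It is evaluated in the preferred chart at `p`, through
which `TangentSpace I p` is identified with `E`. The same holds for the tensors below. -/
def MetricField.curvature (g : MetricField I M) (p : M) (u v w : TangentSpace I p) :
    TangentSpace I p :=
  localCurvature (E := E) (g.inChart p) (extChartAt I p p) u v w

/-- The Ricci tensor of `g` at `p`. -/
def MetricField.ricci (g : MetricField I M) (p : M) (v w : TangentSpace I p) : ℝ :=
  localRicci (E := E) (g.inChart p) (extChartAt I p p) v w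

/-- The Hessian of `f` with respect to `g` at `p`. -/
def MetricField.hessian (g : MetricField I M) (f : M → ℝ) (p : M) (u v : TangentSpace I p) : ℝ :=
  localHessian (E := E) (g.inChart p) (f ∘ (extChartAt I p).symm) (extChartAt I p p) u v

/-- The sectional curvature of the plane spanned by `u` and `v`:
`g(R(u, v)v, u) / (g(u, u) g(v, v) - g(u, v)²)`. -/
def MetricField.sectionalCurvature (g : MetricField I M) (p : M) (u v : TangentSpace I p) : ℝ :=
  g p (g.curvature p u v v) u / (g p u u * g p v v - g p u v ^ 2)

/-- All (nondegenerate) planes at all points have the same sectional curvature. -/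
def MetricField.HasConstantSectionalCurvature (g : MetricField I M) : Prop :=
  ∃ K : ℝ, ∀ (p : M) (u v : TangentSpace I p),
    g p u u * g p v v - g p u v ^ 2 ≠ 0 → g.sectionalCurvature p u v = K

/-- `(g, f, lam)` is a gradient Ricci soliton: `f` is smooth and `Hess f + Ric + lam g = 0`. -/
structure MetricField.IsGradientRicciSoliton (g : MetricField I M) (f : M → ℝ) (lam : ℝ) :
    Prop where
  smooth : ContMDiff I 𝓘(ℝ, ℝ) ∞ f
  soliton : ∀ (p : M) (u v : TangentSpace I p),
    g.hessian f p u v + g.ricci p u v + lam * g p u v = 0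

end Manifolds

/-! ### Generalized Robertson-Walker spacetimes -/

/-- The data of a generalized Robertson-Walker spacetime `-I ×_{F²} N` of dimension `m + 1`:
an open interval `I`, a smooth positive scale factor `F` on `I`, and a smooth
`m`-dimensional Riemannian manifold `N`, the fibre. -/
structure GRWSpacetime (m : ℕ) (N : Type*) [TopologicalSpace N]
    [ChartedSpace (EuclideanSpace ℝ (Fin m)) N] [IsManifold (𝓡 m) ∞ N] where
  interval : TopologicalSpace.Opens ℝ
  isConnected_interval : IsConnected (interval : Set ℝ)
  scale : ℝ → ℝ
  contDiffOn_scale : ContDiffOn ℝ ∞ scale interval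
  scale_pos : ∀ t ∈ interval, 0 < scale t
  fibreMetric : Bundle.ContMDiffRiemannianMetric (𝓡 m) ∞ (EuclideanSpace ℝ (Fin m))
    (fun x : N => TangentSpace (𝓡 m) x)

namespace GRWSpacetime

variable {m : ℕ} {N : Type*} [TopologicalSpace N] [ChartedSpace (EuclideanSpace ℝ (Fin m)) N]
  [IsManifold (𝓡 m) ∞ N]

/-- The underlying manifold `I × N`, with its product smooth structure. -/
abbrev Carrier (S : GRWSpacetime m N) : Type _ := S.interval × N

/-- The model with corners (without boundary) of `I × N`. -/
abbrev model (_S : GRWSpacetime m N) :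
    ModelWithCorners ℝ (ℝ × EuclideanSpace ℝ (Fin m))
      (ModelProd ℝ (EuclideanSpace ℝ (Fin m))) :=
  𝓘(ℝ, ℝ).prod (𝓡 m)

/-- The Riemannian metric of the fibre as a field of bilinear forms. -/
def fibreField (S : GRWSpacetime m N) : MetricField (𝓡 m) N := S.fibreMetric.inner

/-- The Lorentzian warped product metric `-dt² + F(t)² g_N` on `I × N`. -/
def metric (S : GRWSpacetime m N) : MetricField S.model S.Carrier := fun p =>
  let E := EuclideanSpace ℝ (Fin m)
  let dt : ℝ × E →L[ℝ] ℝ := ContinuousLinearMap.fst ℝ ℝ E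
  let π : ℝ × E →L[ℝ] E := ContinuousLinearMap.snd ℝ ℝ E
  let gN : E →L[ℝ] E →L[ℝ] ℝ := S.fibreMetric.inner p.2
  let g : ℝ × E →L[ℝ] ℝ × E →L[ℝ] ℝ :=
    -((ContinuousLinearMap.mul ℝ ℝ).bilinearComp dt dt)
      + (S.scale p.1) ^ 2 • gN.bilinearComp π π
  g

theorem metric_apply (S : GRWSpacetime m N) (p : S.Carrier)
    (u v : ℝ × EuclideanSpace ℝ (Fin m)) :
    S.metric p u v = -(u.1 * v.1) + S.scale p.1 ^ 2 * S.fibreMetric.inner p.2 u.2 v.2 := rfl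

/-- The unit timelike vector field `ρ = ∂/∂t`. -/
def rho (S : GRWSpacetime m N) (p : S.Carrier) : TangentSpace S.model p :=
  ((1 : ℝ), (0 : EuclideanSpace ℝ (Fin m)))

/-- The derivative `ρ f` of a function `f` along `ρ`. -/
def rhoDeriv (S : GRWSpacetime m N) (f : S.Carrier → ℝ) (p : S.Carrier) : ℝ :=
  mfderiv S.model 𝓘(ℝ, ℝ) f p (S.rho p)

/-- A four-dimensional generalized Robertson-Walker spacetime is a Robertson-Walker spacetime if
its (three-dimensional) fibre has constant sectional curvature. -/
def IsRobertsonWalker {N : Type*} [TopologicalSpace N]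
    [ChartedSpace (EuclideanSpace ℝ (Fin 3)) N] [IsManifold (𝓡 3) ∞ N]
    (S : GRWSpacetime 3 N) : Prop :=
  S.fibreField.HasConstantSectionalCurvature

end GRWSpacetime

end

/-! Write `F` for the scale factor, `g_N` for the fibre metric, `c` for the constant value of `ρ f`,
and let `X`, `Y` be tangent to the fibre. In the soliton equation at `(X, ρ)` the metric and Ricci
terms vanish, because a warped product has no mixed Ricci curvature. Since `∇_X ρ = (F'/F) X` and
`X(ρ f) = 0`, what remains is `(F'/F) df(X) = 0`. So `df = c dt` wherever `F' ≠ 0`, and such a time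
`t` exists because `F` is not constant.

Near this `t` the Hessian on fibre vectors is `-c F F' g_N(X, Y)`, while the Ricci tensor of the
warped product is `Ric_N + (F F'' + 2 F'²) g_N`. The equation at `(X, Y)` then gives `Ric_N = μ
g_N`, where `μ` depends only on the fixed `t`. Thus `N` is Einstein with one constant for all its
points; neither Schur's lemma nor connectedness of `N` is needed. In dimension three an Einstein
metric has constant sectional curvature `μ / 2`.

The carriers are `localRicci_warpedMetric_mixed`, `localRicci_warpedMetric` and
`IsMetricNear.sectional_of_einstein`; `GRWSpacetime.metric_inChart` transfers the local formulas to
the spacetime. All tensors at a point are computed in the preferred chart there, so coordinate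
invariance is never invoked. -/

/-! ### Local calculus -/

section LocalCalculusLemmas

open Filter Topology

variable {E : Type*} [NormedAddCommGroup E] [NormedSpace ℝ E]
  {G G' : E → E →L[ℝ] E →L[ℝ] ℝ} {y : E}

/-- Regular semi-Riemannian metrics near a point: `C²`, symmetric and nondegenerate. -/
structure IsMetricNear (G : E → E →L[ℝ] E →L[ℝ] ℝ) (y : E) : Prop where
  contDiffAt : ContDiffAt ℝ 2 G y
  symm : ∀ᶠ z in 𝓝 y, ∀ u v, G z u v = G z v u
  isInvertible : ∀ᶠ z in 𝓝 y, (G z).IsInvertible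

theorem IsMetricNear.differentiableAt (h : IsMetricNear G y) : DifferentiableAt ℝ G y :=
  h.contDiffAt.differentiableAt (by norm_num)

theorem IsMetricNear.eventually (h : IsMetricNear G y) : ∀ᶠ z in 𝓝 y, IsMetricNear G z := by
  filter_upwards [h.contDiffAt.eventually (by simp), h.symm.eventually_nhds,
    h.isInvertible.eventually_nhds] with z h₁ h₂ h₃ using ⟨h₁, h₂, h₃⟩

theorem fderiv_apply₂ {E' F₁ F₂ F₃ : Type*} [NormedAddCommGroup E'] [NormedSpace ℝ E']
    [NormedAddCommGroup F₁] [NormedSpace ℝ F₁] [NormedAddCommGroup F₂] [NormedSpace ℝ F₂]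
    [NormedAddCommGroup F₃] [NormedSpace ℝ F₃] {G : E' → F₁ →L[ℝ] F₂ →L[ℝ] F₃} {y : E'}
    (hG : DifferentiableAt ℝ G y) (w : E') (u : F₁) (v : F₂) :
    fderiv ℝ G y w u v = fderiv ℝ (fun z => G z u v) y w := by
  have h := (hG.hasFDerivAt.clm_apply (hasFDerivAt_const u y)).clm_apply (hasFDerivAt_const v y)
  rw [h.fderiv]
  simp

theorem IsMetricNear.fderiv_symm (h : IsMetricNear G y) (w u v : E) :
    fderiv ℝ G y w u v = fderiv ℝ G y w v u := by
  rw [fderiv_apply₂ h.differentiableAt, fderiv_apply₂ h.differentiableAt]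
  have : (fun z => G z u v) =ᶠ[𝓝 y] fun z => G z v u := by
    filter_upwards [h.symm] with z hz using hz u v
  rw [this.fderiv_eq]

theorem IsMetricNear.apply_christoffel (h : IsMetricNear G y) (u v w : E) :
    G y (christoffel G y u v) w = christoffelLower G y u v w := by
  rw [christoffel_apply, h.isInvertible.self_of_nhds.self_apply_inverse]

theorem IsMetricNear.christoffel_symm (h : IsMetricNear G y) (u v : E) :
    christoffel G y u v = christoffel G y v u := by
  rw [christoffel_apply, christoffel_apply]
  congr 1
  ext w
  rw [christoffelLower_apply, christoffelLower_apply, h.fderiv_symm w u v]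
  ring

/-- The Levi-Civita connection is compatible with the metric. -/
theorem IsMetricNear.fderiv_eq (h : IsMetricNear G y) (u v w : E) :
    fderiv ℝ G y u v w = G y (christoffel G y u v) w + G y v (christoffel G y u w) := by
  rw [h.symm.self_of_nhds v, h.apply_christoffel, h.apply_christoffel, christoffelLower_apply,
    christoffelLower_apply, h.fderiv_symm u w v, h.fderiv_symm w u v, h.fderiv_symm v u w]
  ring

/-- By nondegeneracy, Christoffel symbols can be proposed and then checked against the lowered ones,
without computing the inverse metric. -/
theorem IsMetricNear.christoffel_eq (h : IsMetricNear G y) {u v x : E}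
    (hx : ∀ w, G y x w = christoffelLower G y u v w) : christoffel G y u v = x := by
  apply h.isInvertible.self_of_nhds.injective
  ext w
  rw [h.apply_christoffel, hx]

theorem christoffelLower_congr (h : G =ᶠ[𝓝 y] G') :
    christoffelLower G y = christoffelLower G' y := by
  ext u v w
  simp only [christoffelLower_apply, h.fderiv_eq]

theorem christoffel_congr (h : G =ᶠ[𝓝 y] G') : christoffel G =ᶠ[𝓝 y] christoffel G' := by
  filter_upwards [h.eventuallyEq_nhds] with z hz
  ext u v
  rw [christoffel_apply, christoffel_apply, christoffelLower_congr hz, hz.self_of_nhds]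

/-- The tensors see only the germ of the metric. This matters because the spacetime metric in a
chart is a warped product only near the base point. -/
theorem localCurvature_congr (h : G =ᶠ[𝓝 y] G') (u v w : E) :
    localCurvature G y u v w = localCurvature G' y u v w := by
  simp only [localCurvature, (christoffel_congr h).fderiv_eq, (christoffel_congr h).self_of_nhds]

theorem localRicci_congr (h : G =ᶠ[𝓝 y] G') (v w : E) :
    localRicci G y v w = localRicci G' y v w := by
  simp only [localRicci, localCurvature_congr h]

theorem localHessian_congr (h : G =ᶠ[𝓝 y] G') (φ : E → ℝ) (v w : E) :
    localHessian G φ y v w = localHessian G' φ y v w := by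
  simp only [localHessian, (christoffel_congr h).self_of_nhds]

theorem IsMetricNear.differentiableAt_christoffel [FiniteDimensional ℝ E] (h : IsMetricNear G y) :
    DifferentiableAt ℝ (christoffel G) y := by
  have : CompleteSpace E := FiniteDimensional.complete ℝ E
  have hinv : DifferentiableAt ℝ (fun z => (G z).inverse) y :=
    (h.isInvertible.self_of_nhds.contDiffAt_map_inverse (n := 2)).differentiableAt
      (by norm_num) |>.comp y h.differentiableAt
  have hD : DifferentiableAt ℝ (fderiv ℝ G) y :=
    (h.contDiffAt.fderiv_right (m := 1) (by norm_num)).differentiableAt (by norm_num)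
  have hL : DifferentiableAt ℝ (christoffelLower G) y := by
    let fl : (E →L[ℝ] E →L[ℝ] E →L[ℝ] ℝ) →L[ℝ] E →L[ℝ] E →L[ℝ] E →L[ℝ] ℝ :=
      (ContinuousLinearMap.flipₗᵢ ℝ E E (E →L[ℝ] ℝ)).toContinuousLinearEquiv
    let fl' : (E →L[ℝ] E →L[ℝ] ℝ) →L[ℝ] E →L[ℝ] E →L[ℝ] ℝ :=
      (ContinuousLinearMap.flipₗᵢ ℝ E E ℝ).toContinuousLinearEquiv
    have h₁ : DifferentiableAt ℝ (fun z => fl (fderiv ℝ G z)) y :=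
      fl.differentiableAt.comp y hD
    exact ((hD.add h₁).sub ((differentiableAt_const fl').clm_comp h₁)).const_smul (2⁻¹ : ℝ)
  have hC : DifferentiableAt ℝ
      (fun z => ContinuousLinearMap.compL ℝ E (E →L[ℝ] ℝ) E (G z).inverse) y :=
    (ContinuousLinearMap.compL ℝ E (E →L[ℝ] ℝ) E).differentiableAt.comp y hinv
  exact hC.clm_comp hL

theorem IsMetricNear.fderiv_christoffel_apply [FiniteDimensional ℝ E] (h : IsMetricNear G y)
    (u v w : E) :
    fderiv ℝ (christoffel G) y u v w = fderiv ℝ (fun z => christoffel G z v w) y u :=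
  fderiv_apply₂ h.differentiableAt_christoffel u v w

theorem localCurvature_swap (u v w : E) :
    localCurvature G y u v w = -localCurvature G y v u w := by
  simp only [localCurvature]; abel

/-- Second derivatives of the metric commute. Expressing them through the connection and
antisymmetrizing in `u`, `v` leaves exactly the two curvature terms. -/
theorem IsMetricNear.localCurvature_skew [FiniteDimensional ℝ E] (h : IsMetricNear G y)
    (u v w x : E) :
    G y (localCurvature G y u v w) x = -G y (localCurvature G y u v x) w := by
  have hΓ := h.differentiableAt_christoffel.hasFDerivAt
  have hG := h.differentiableAt.hasFDerivAt
  have hD : DifferentiableAt ℝ (fderiv ℝ G) y :=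
    (h.contDiffAt.fderiv_right (m := 1) (by norm_num)).differentiableAt (by norm_num)
  -- Metric compatibility is differentiated along `a`, and each new derivative of `G` is again
  -- replaced by Christoffel terms.
  have key (a b : E) : fderiv ℝ (fderiv ℝ G) y a b w x =
      G y (christoffel G y a (christoffel G y b w)) x
        + G y (christoffel G y b w) (christoffel G y a x)
        + G y (fderiv ℝ (christoffel G) y a b w) x
        + G y (christoffel G y a w) (christoffel G y b x)
        + G y w (christoffel G y a (christoffel G y b x))
        + G y w (fderiv ℝ (christoffel G) y a b x) := by
    have h₀ : HasFDerivAt (fun z => fderiv ℝ G z b w x) _ y :=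
      ((hD.hasFDerivAt.clm_apply (hasFDerivAt_const b y)).clm_apply
        (hasFDerivAt_const w y)).clm_apply (hasFDerivAt_const x y)
    have hc (c : E) := (hΓ.clm_apply (hasFDerivAt_const b y)).clm_apply (hasFDerivAt_const c y)
    have h₁ := (hG.clm_apply (hc w)).clm_apply (hasFDerivAt_const x y)
    have h₂ := (hG.clm_apply (hasFDerivAt_const w y)).clm_apply (hc x)
    have h₃ := h₁.add h₂
    have he : (fun z => fderiv ℝ G z b w x) =ᶠ[𝓝 y]
        fun z => G z (christoffel G z b w) x + G z w (christoffel G z b x) := by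
      filter_upwards [h.eventually] with z hz using hz.fderiv_eq b w x
    have h₄ := congrArg (fun L : E →L[ℝ] ℝ => L a) (h₀.unique (h₃.congr_of_eventuallyEq he))
    simp at h₄
    rw [h₄, h.fderiv_eq a, h.fderiv_eq a]
    ring
  have hsymm : fderiv ℝ (fderiv ℝ G) y u v = fderiv ℝ (fderiv ℝ G) y v u :=
    h.contDiffAt.isSymmSndFDerivAt (by simp) u v
  have h₁ := key u v
  rw [hsymm, key v u] at h₁
  have hs := h.symm.self_of_nhds
  rw [hs (localCurvature G y u v x)]
  simp only [localCurvature, map_add, map_sub, add_apply, sub_apply]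
  linarith

end LocalCalculusLemmas

/-! ### Warped products -/

section WarpedProduct

open Filter Topology

variable {V : Type*} [NormedAddCommGroup V] [NormedSpace ℝ V]

theorem ContinuousLinearMap.isInvertible_of_nondegenerate [FiniteDimensional ℝ V]
    (B : V →L[ℝ] V →L[ℝ] ℝ) (h : ∀ u, (∀ v, B u v = 0) → u = 0) : B.IsInvertible := by
  have hdim : Module.finrank ℝ V = Module.finrank ℝ (V →L[ℝ] ℝ) := by
    rw [← (LinearMap.toContinuousLinearMap (𝕜 := ℝ) (E := V) (F' := ℝ)).finrank_eq]
    exact Subspace.dual_finrank_eq.symm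
  have hinj : Function.Injective (B : V →ₗ[ℝ] V →L[ℝ] ℝ) := by
    rw [injective_iff_map_eq_zero]
    intro u hu
    refine h u fun v => ?_
    change (B : V →ₗ[ℝ] V →L[ℝ] ℝ) u v = 0
    rw [hu]; rfl
  exact ⟨(LinearMap.linearEquivOfInjective _ hinj hdim).toContinuousLinearEquiv, by ext; rfl⟩

theorem LinearMap.trace_real (T : ℝ →ₗ[ℝ] ℝ) : LinearMap.trace ℝ ℝ T = T 1 := by
  rw [LinearMap.trace_eq_matrix_trace ℝ (Module.Basis.singleton Unit ℝ)]
  simp [Matrix.trace, LinearMap.toMatrix_apply]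

/-- `T` splits through the two projections, and cyclicity of the trace reduces each summand to a
diagonal block. -/
theorem LinearMap.trace_real_prod [FiniteDimensional ℝ V] (T : ℝ × V →ₗ[ℝ] ℝ × V) :
    LinearMap.trace ℝ (ℝ × V) T = (T (1, 0)).1 +
      LinearMap.trace ℝ V (LinearMap.snd ℝ ℝ V ∘ₗ T ∘ₗ LinearMap.inr ℝ ℝ V) := by
  have h : T = (T ∘ₗ LinearMap.inl ℝ ℝ V) ∘ₗ LinearMap.fst ℝ ℝ V
      + (T ∘ₗ LinearMap.inr ℝ ℝ V) ∘ₗ LinearMap.snd ℝ ℝ V := by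
    refine LinearMap.ext fun x => ?_
    change T x = T (x.1, 0) + T (0, x.2)
    rw [← map_add, Prod.mk_add_mk, add_zero, zero_add]
  conv_lhs => rw [h]
  rw [map_add, LinearMap.trace_comp_comm', LinearMap.trace_comp_comm' (LinearMap.snd ℝ ℝ V),
    LinearMap.trace_real]
  rfl

/-- The warped product metric `-ds² + F(s)² H` on `ℝ × V`. -/
noncomputable def warpedMetric (F : ℝ → ℝ) (H : V → V →L[ℝ] V →L[ℝ] ℝ) (y : ℝ × V) :
    ℝ × V →L[ℝ] ℝ × V →L[ℝ] ℝ :=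
  -((ContinuousLinearMap.mul ℝ ℝ).bilinearComp (ContinuousLinearMap.fst ℝ ℝ V)
      (ContinuousLinearMap.fst ℝ ℝ V))
    + (F y.1) ^ 2 • (H y.2).bilinearComp (ContinuousLinearMap.snd ℝ ℝ V)
      (ContinuousLinearMap.snd ℝ ℝ V)

variable {F : ℝ → ℝ} {H : V → V →L[ℝ] V →L[ℝ] ℝ} {s : ℝ} {z : V}

theorem warpedMetric_apply (F : ℝ → ℝ) (H : V → V →L[ℝ] V →L[ℝ] ℝ) (y u v : ℝ × V) :
    warpedMetric F H y u v = -(u.1 * v.1) + F y.1 ^ 2 * H y.2 u.2 v.2 := rfl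

theorem IsMetricNear.warped [FiniteDimensional ℝ V] (h : IsMetricNear H z)
    (hF : ContDiffAt ℝ 2 F s) (hs : F s ≠ 0) : IsMetricNear (warpedMetric F H) (s, z) where
  contDiffAt := by
    -- `bilinearComp` is composition, flip, composition, flip; this exhibits it as a smooth
    -- operation on `H`.
    let fl₁ : ((ℝ × V) →L[ℝ] V →L[ℝ] ℝ) →L[ℝ] V →L[ℝ] (ℝ × V) →L[ℝ] ℝ :=
      (ContinuousLinearMap.flipₗᵢ ℝ (ℝ × V) V ℝ).toContinuousLinearEquiv
    let fl₂ : ((ℝ × V) →L[ℝ] (ℝ × V) →L[ℝ] ℝ) →L[ℝ] (ℝ × V) →L[ℝ] (ℝ × V) →L[ℝ] ℝ :=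
      (ContinuousLinearMap.flipₗᵢ ℝ (ℝ × V) (ℝ × V) ℝ).toContinuousLinearEquiv
    have hH : ContDiffAt ℝ 2 (fun y : ℝ × V => H y.2) (s, z) :=
      ContDiffAt.comp (s, z) h.contDiffAt contDiffAt_snd
    have h₁ : ContDiffAt ℝ 2 (fun y : ℝ × V =>
        fl₁ ((H y.2).comp (ContinuousLinearMap.snd ℝ ℝ V))) (s, z) :=
      fl₁.contDiff.contDiffAt.comp (s, z) (hH.clm_comp contDiffAt_const)
    have h₂ : ContDiffAt ℝ 2 (fun y : ℝ × V =>
        fl₂ ((fl₁ ((H y.2).comp (ContinuousLinearMap.snd ℝ ℝ V))).comp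
          (ContinuousLinearMap.snd ℝ ℝ V))) (s, z) :=
      fl₂.contDiff.contDiffAt.comp (s, z) (h₁.clm_comp contDiffAt_const)
    have hF' : ContDiffAt ℝ 2 (fun y : ℝ × V => F y.1) (s, z) :=
      ContDiffAt.comp (s, z) hF contDiffAt_fst
    exact contDiffAt_const.add ((hF'.pow 2).smul h₂)
  symm := by
    have : Tendsto (Prod.snd : ℝ × V → V) (𝓝 (s, z)) (𝓝 z) := continuous_snd.tendsto _
    filter_upwards [this.eventually h.symm] with y hy u v
    rw [warpedMetric_apply, warpedMetric_apply, hy, mul_comm u.1]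
  isInvertible := by
    have h₂ : Tendsto (Prod.snd : ℝ × V → V) (𝓝 (s, z)) (𝓝 z) := continuous_snd.tendsto _
    have h₁ : Tendsto (Prod.fst : ℝ × V → ℝ) (𝓝 (s, z)) (𝓝 s) := continuous_fst.tendsto _
    filter_upwards [h₂.eventually h.isInvertible,
      h₁.eventually (hF.continuousAt.eventually_ne hs)] with y hy hFy
    refine ContinuousLinearMap.isInvertible_of_nondegenerate _ fun u hu => ?_
    have hu₁ : u.1 = 0 := by simpa [warpedMetric_apply] using hu (1, 0)
    have hu₂ : u.2 = 0 := by
      apply hy.injective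
      ext v
      simpa [warpedMetric_apply, hFy] using hu (0, v)
    exact Prod.ext hu₁ hu₂

theorem hasFDerivAt_smul_prod {p : ℝ → ℝ} {W : Type*} [NormedAddCommGroup W] [NormedSpace ℝ W]
    {q : V → W} (hp : DifferentiableAt ℝ p s) (hq : DifferentiableAt ℝ q z) :
    HasFDerivAt (fun y : ℝ × V => p y.1 • q y.2)
      ((deriv p s • ContinuousLinearMap.fst ℝ ℝ V).smulRight (q z)
        + p s • (fderiv ℝ q z).comp (ContinuousLinearMap.snd ℝ ℝ V)) (s, z) := by
  have h₁ : HasFDerivAt (fun y : ℝ × V => p y.1) _ (s, z) :=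
    hp.hasFDerivAt.comp (s, z) hasFDerivAt_fst
  have h₂ : HasFDerivAt (fun y : ℝ × V => q y.2) _ (s, z) :=
    hq.hasFDerivAt.comp (s, z) hasFDerivAt_snd
  have h₃ : HasFDerivAt (fun y : ℝ × V => p y.1 • q y.2) _ (s, z) := h₁.smul h₂
  refine h₃.congr_fderiv (ContinuousLinearMap.ext fun x => ?_)
  simp [add_comm, mul_comm]

theorem fderiv_warpedMetric [FiniteDimensional ℝ V] (h : IsMetricNear H z)
    (hF : ContDiffAt ℝ 2 F s) (hs : F s ≠ 0) (x u v : ℝ × V) :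
    fderiv ℝ (warpedMetric F H) (s, z) x u v =
      2 * F s * deriv F s * x.1 * H z u.2 v.2 + F s ^ 2 * fderiv ℝ H z x.2 u.2 v.2 := by
  have hF₁ : DifferentiableAt ℝ F s := hF.differentiableAt (by norm_num)
  have hH : DifferentiableAt ℝ (fun z => H z u.2 v.2) z :=
    (h.differentiableAt.clm_apply (differentiableAt_const _)).clm_apply (differentiableAt_const _)
  rw [fderiv_apply₂ (h.warped hF hs).differentiableAt, fderiv_apply₂ h.differentiableAt]
  simp only [warpedMetric_apply, fderiv_const_add]
  have := hasFDerivAt_smul_prod (p := fun s => F s ^ 2) (hF₁.pow 2) hH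
  simp only [smul_eq_mul] at this
  rw [this.fderiv, deriv_fun_pow hF₁]
  simp [mul_right_comm _ x.1]

theorem christoffel_warpedMetric [FiniteDimensional ℝ V] (h : IsMetricNear H z)
    (hF : ContDiffAt ℝ 2 F s) (hs : F s ≠ 0) (u v : ℝ × V) :
    christoffel (warpedMetric F H) (s, z) u v =
      (F s * deriv F s * H z u.2 v.2,
        christoffel H z u.2 v.2 + (deriv F s / F s) • (u.1 • v.2 + v.1 • u.2)) := by
  refine (h.warped hF hs).christoffel_eq fun w => ?_
  rw [warpedMetric_apply, christoffelLower_apply]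
  simp only [fderiv_warpedMetric h hF hs, map_add, map_smul, add_apply, smul_apply,
    h.apply_christoffel, christoffelLower_apply, smul_eq_mul]
  field_simp
  ring

theorem fderiv_christoffel_warpedMetric [FiniteDimensional ℝ V] (h : IsMetricNear H z)
    (hF : ContDiffAt ℝ 2 F s) (hs : F s ≠ 0) (x u v : ℝ × V) :
    fderiv ℝ (christoffel (warpedMetric F H)) (s, z) x u v =
      (x.1 * (deriv F s ^ 2 + F s * deriv (deriv F) s) * H z u.2 v.2
          + F s * deriv F s * fderiv ℝ H z x.2 u.2 v.2,
        fderiv ℝ (christoffel H) z x.2 u.2 v.2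
          + (x.1 * deriv (fun s => deriv F s / F s) s) • (u.1 • v.2 + v.1 • u.2)) := by
  have hF₁ : DifferentiableAt ℝ F s := hF.differentiableAt (by norm_num)
  have hF₂ : DifferentiableAt ℝ (deriv F) s := by
    have := ((hF.fderiv_right (m := 1) (by norm_num)).differentiableAt (by norm_num))
    exact this.clm_apply (differentiableAt_const (1 : ℝ))
  have hH : DifferentiableAt ℝ (fun z => H z u.2 v.2) z :=
    (h.differentiableAt.clm_apply (differentiableAt_const _)).clm_apply (differentiableAt_const _)
  have hΓ : DifferentiableAt ℝ (fun z => christoffel H z u.2 v.2) z :=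
    (h.differentiableAt_christoffel.clm_apply (differentiableAt_const _)).clm_apply
      (differentiableAt_const _)
  have hq : DifferentiableAt ℝ (fun s => deriv F s / F s) s := hF₂.div hF₁ hs
  rw [(h.warped hF hs).fderiv_christoffel_apply, h.fderiv_christoffel_apply,
    fderiv_apply₂ h.differentiableAt]
  have t₂ : Tendsto (Prod.snd : ℝ × V → V) (𝓝 (s, z)) (𝓝 z) := continuous_snd.tendsto _
  have t₁ : Tendsto (Prod.fst : ℝ × V → ℝ) (𝓝 (s, z)) (𝓝 s) := continuous_fst.tendsto _
  -- The derivative needs the Christoffel formula on a whole neighbourhood. It is arranged as sums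
  -- of products `p(s) • q(z)`, whence the factor `1`.
  have he : (fun y => christoffel (warpedMetric F H) y u v) =ᶠ[𝓝 (s, z)] fun y =>
      ((F y.1 * deriv F y.1) • H y.2 u.2 v.2,
        (1 : ℝ) • christoffel H y.2 u.2 v.2
          + (deriv F y.1 / F y.1) • (u.1 • v.2 + v.1 • u.2)) := by
    filter_upwards [t₂.eventually h.eventually, t₁.eventually (hF.eventually (by simp)),
      t₁.eventually (hF.continuousAt.eventually_ne hs)] with y h₁ h₂ h₃
    rw [one_smul]
    exact christoffel_warpedMetric h₁ h₂ h₃ u v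
  have d₁ := hasFDerivAt_smul_prod (p := fun s => F s * deriv F s) (hF₁.mul hF₂) hH
  have d₂ := hasFDerivAt_smul_prod (differentiableAt_const (1 : ℝ) (x := s)) hΓ
  have d₃ := hasFDerivAt_smul_prod hq (differentiableAt_const (u.1 • v.2 + v.1 • u.2) (x := z))
  rw [he.fderiv_eq, (d₁.prodMk (d₂.fun_add d₃)).fderiv, deriv_fun_mul hF₁ hF₂]
  refine Prod.ext ?_ ?_
  · simp only [ContinuousLinearMap.prod_apply, add_apply, ContinuousLinearMap.smulRight_apply,
      smul_apply, ContinuousLinearMap.comp_apply, ContinuousLinearMap.coe_fst',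
      ContinuousLinearMap.coe_snd', smul_eq_mul]
    ring
  · simp [mul_comm]

/-- For fibre vectors `u`, `v`, the fibre part of `R(u, v)ρ` is zero by symmetry of the Christoffel
symbols, and so is the `ρ` component of `R(ρ, v)ρ`. -/
theorem localRicci_warpedMetric_mixed [FiniteDimensional ℝ V] (h : IsMetricNear H z)
    (hF : ContDiffAt ℝ 2 F s) (hs : F s ≠ 0) (v : V) :
    localRicci (warpedMetric F H) (s, z) (0, v) (1, 0) = 0 := by
  rw [localRicci, LinearMap.trace_real_prod]
  have h₀ : (LinearMap.snd ℝ ℝ V ∘ₗ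
      { toFun := fun u => localCurvature (warpedMetric F H) (s, z) u (0, v) (1, 0)
        map_add' := fun a b => by simp only [localCurvature, map_add, add_apply]; abel
        map_smul' := fun c a => by
          simp only [localCurvature, map_smul, smul_apply, RingHom.id_apply, smul_add, smul_sub] }
      ∘ₗ LinearMap.inr ℝ ℝ V) = 0 := by
    ext u
    simp [localCurvature, christoffel_warpedMetric h hF hs,
      fderiv_christoffel_warpedMetric h hF hs, h.christoffel_symm u v]
  rw [h₀]
  simp [localCurvature, christoffel_warpedMetric h hF hs,
      fderiv_christoffel_warpedMetric h hF hs]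

/-- The fibre part of `R(u, v)w` is the fibre curvature plus `F'² (H(v, w) u - H(u, w) v)`, whose
trace gives the factor `dim V - 1`; the `ρ` component of `R(ρ, v)w` contributes `F F''`. -/
theorem localRicci_warpedMetric [FiniteDimensional ℝ V] (h : IsMetricNear H z)
    (hF : ContDiffAt ℝ 2 F s) (hs : F s ≠ 0) (v w : V) :
    localRicci (warpedMetric F H) (s, z) (0, v) (0, w) = localRicci H z v w
      + (F s * deriv (deriv F) s + (Module.finrank ℝ V - 1) * deriv F s ^ 2) * H z v w := by
  rw [localRicci, LinearMap.trace_real_prod]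
  have h₀ : (LinearMap.snd ℝ ℝ V ∘ₗ
      { toFun := fun u => localCurvature (warpedMetric F H) (s, z) u (0, v) (0, w)
        map_add' := fun a b => by simp only [localCurvature, map_add, add_apply]; abel
        map_smul' := fun c a => by
          simp only [localCurvature, map_smul, smul_apply, RingHom.id_apply, smul_add, smul_sub] }
      ∘ₗ LinearMap.inr ℝ ℝ V) =
      { toFun := fun u => localCurvature H z u v w
        map_add' := fun a b => by simp only [localCurvature, map_add, add_apply]; abel
        map_smul' := fun c a => by
          simp only [localCurvature, map_smul, smul_apply, RingHom.id_apply, smul_add,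
            smul_sub] }
      + ((deriv F s ^ 2 * H z v w) • LinearMap.id
        - deriv F s ^ 2 • ((H z).flip w : V →ₗ[ℝ] ℝ).smulRight v) := by
    ext u
    simp [localCurvature, christoffel_warpedMetric h hF hs,
      fderiv_christoffel_warpedMetric h hF hs, smul_smul]
    have e (a : ℝ) : deriv F s / F s * (F s * deriv F s * a) = deriv F s ^ 2 * a := by
      field_simp
    rw [e, e]
    abel
  rw [h₀, map_add, map_sub, map_smul, map_smul, LinearMap.trace_id, LinearMap.trace_smulRight]
  simp [localCurvature, christoffel_warpedMetric h hF hs,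
      fderiv_christoffel_warpedMetric h hF hs, localRicci]
  field_simp
  ring

end WarpedProduct

/-! ### Einstein metrics in dimension three -/

section EinsteinThree

variable {V : Type*} [NormedAddCommGroup V] [NormedSpace ℝ V]

theorem trace_eq_sum_of_orthogonal [FiniteDimensional ℝ V] {n : ℕ} (B : V →L[ℝ] V →L[ℝ] ℝ)
    (hn : Module.finrank ℝ V = n) (e : Fin n → V) (he : ∀ i j, i ≠ j → B (e i) (e j) = 0)
    (he₀ : ∀ i, B (e i) (e i) ≠ 0) (T : V →ₗ[ℝ] V) :
    LinearMap.trace ℝ V T = ∑ i, B (T (e i)) (e i) / B (e i) (e i) := by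
  have hli : LinearIndependent ℝ e := by
    rw [Fintype.linearIndependent_iff]
    intro c hc i
    have h := congrArg (fun x => B x (e i)) hc
    simp only [map_sum, map_smul, sum_apply, smul_apply, smul_eq_mul,
      map_zero, zero_apply] at h
    rw [Finset.sum_eq_single i (fun j _ hj => by rw [he j i hj, mul_zero]) (by simp)] at h
    exact (mul_eq_zero.1 h).resolve_right (he₀ i)
  let b := basisOfLinearIndependentOfCardEqFinrank' e hli (by simp [hn])
  have hb (i) : b i = e i := by simp [b]
  rw [LinearMap.trace_eq_matrix_trace ℝ b, Matrix.trace]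
  refine Finset.sum_congr rfl fun i _ => ?_
  rw [Matrix.diag_apply, LinearMap.toMatrix_apply, hb, eq_div_iff (he₀ i)]
  conv_rhs => rw [← b.sum_repr (T (e i))]
  simp only [map_sum, map_smul, sum_apply, smul_apply, smul_eq_mul, hb]
  rw [Finset.sum_eq_single i (fun j _ hj => by rw [he j i hj, mul_zero]) (by simp)]

/-- In dimension three, the sectional curvature of an Einstein metric is half of the Einstein
constant. -/
theorem IsMetricNear.sectional_of_einstein {G : V → V →L[ℝ] V →L[ℝ] ℝ} {y : V}
    (h : IsMetricNear G y) (hV : Module.finrank ℝ V = 3) (hpos : ∀ u, u ≠ 0 → 0 < G y u u) {μ : ℝ}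
    (hRic : ∀ u v, localRicci G y u v = μ * G y u v) (u v : V)
    (huv : G y u u * G y v v - G y u v ^ 2 ≠ 0) :
    G y (localCurvature G y u v v) u / (G y u u * G y v v - G y u v ^ 2) = μ / 2 := by
  have : FiniteDimensional ℝ V := FiniteDimensional.of_finrank_eq_succ hV
  have hs := h.symm.self_of_nhds
  have hu : u ≠ 0 := by rintro rfl; simp at huv
  have hu₀ := hpos u hu
  -- Gram–Schmidt: `w` is the part of `v` orthogonal to `u`, and replacing `v` by `w` changes
  -- neither numerator nor denominator.
  obtain ⟨w, hw⟩ : ∃ w, w = v - (G y u v / G y u u) • u := ⟨_, rfl⟩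
  have hv : v = w + (G y u v / G y u u) • u := by rw [hw]; abel
  have huw : G y u w = 0 := by rw [hw]; simp [hu₀.ne']
  have hdisc : G y u u * G y v v - G y u v ^ 2 = G y u u * G y w w := by
    rw [hw]
    simp only [map_sub, map_smul, sub_apply, smul_apply, smul_eq_mul, hs v u]
    field_simp
    ring
  have hw₀ : w ≠ 0 := by rintro rfl; simp [hdisc] at huv
  have hself (a b c : V) : G y (localCurvature G y a b c) c = 0 := by
    linarith [h.localCurvature_skew a b c c]
  have hzero (a b : V) : localCurvature G y a a b = 0 := by
    simp [localCurvature]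
  have hnum : G y (localCurvature G y u v v) u = G y (localCurvature G y u w w) u := by
    generalize G y u v / G y u u = k at hv
    have e : localCurvature G y u v v = localCurvature G y u w w + k • localCurvature G y u w u
        + k • localCurvature G y u u w + (k * k) • localCurvature G y u u u := by
      rw [hv]
      simp only [localCurvature, map_add, map_smul, add_apply, smul_apply, smul_add, smul_sub,
        smul_smul]
      abel
    rw [e, hzero, hzero]
    simp [hself]
  -- Symmetry of sectional curvature follows from skewness in the first and last pairs alone,
  -- without the Bianchi identity.
  have hS (a b : V) : G y (localCurvature G y b a a) b = G y (localCurvature G y a b b) a := by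
    rw [localCurvature_swap b a a, map_neg, neg_apply, h.localCurvature_skew a b a b, neg_neg]
  obtain ⟨x, hx, hx₀⟩ : ∃ x, (G y u x = 0 ∧ G y w x = 0) ∧ x ≠ 0 := by
    have hk := LinearMap.ker_ne_bot_of_finrank_lt
      (f := ((G y u : V →ₗ[ℝ] ℝ).prod (G y w : V →ₗ[ℝ] ℝ))) (by simp [hV])
    obtain ⟨x, hx, hx₀⟩ := Submodule.exists_mem_ne_zero_of_ne_bot hk
    rw [LinearMap.mem_ker] at hx
    exact ⟨x, Prod.ext_iff.1 hx, hx₀⟩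
  have hw₁ := hpos w hw₀
  have hx₁ := hpos x hx₀
  have htr (a : V) : G y (localCurvature G y u a a) u / G y u u
      + G y (localCurvature G y w a a) w / G y w w
      + G y (localCurvature G y x a a) x / G y x x = μ * G y a a := by
    rw [← hRic, localRicci, trace_eq_sum_of_orthogonal (G y) hV ![u, w, x] ?_ ?_]
    · simp [Fin.sum_univ_three]
    · intro i j hij
      fin_cases i <;> fin_cases j <;>
        simp [hx.1, hx.2, huw, hs w u, hs x u, hs x w] at hij ⊢
    · intro i
      fin_cases i <;> simp [hu₀.ne', hw₁.ne', hx₁.ne']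
  have h₁ := htr u
  have h₂ := htr w
  have h₃ := htr x
  simp only [hzero, map_zero, zero_apply, zero_div, zero_add, add_zero] at h₁ h₂ h₃
  rw [hS u w, hS u x] at h₁
  rw [hS w x] at h₂
  rw [hdisc, hnum]
  field_simp at h₁ h₂ h₃ ⊢
  generalize G y (localCurvature G y u w w) u = A at *
  generalize G y (localCurvature G y u x x) u = B at *
  generalize G y (localCurvature G y w x x) w = C at *
  generalize G y u u = p at *
  generalize G y w w = q at *
  generalize G y x x = r at *
  -- For the orthogonal basis `u, w, x` the Einstein equations say that any two of the three
  -- sectional curvatures add to `μ`, so `(K_uw + K_ux) + (K_uw + K_wx) - (K_ux + K_wx) = 2 K_uw =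
  -- μ`. The factor `G(x, x)` comes from clearing denominators.
  apply mul_right_cancel₀ hx₁.ne'
  linear_combination h₁ + h₂ - h₃

end EinsteinThree

/-! ### Metrics in charts -/

section Charts

open Filter Topology Bundle

variable {E : Type*} [NormedAddCommGroup E] [NormedSpace ℝ E]
  {H : Type*} [TopologicalSpace H] {I : ModelWithCorners ℝ E H} [I.Boundaryless]
  {M : Type*} [TopologicalSpace M] [ChartedSpace H M]

theorem mfderiv_extChartAt_symm_self [IsManifold I 1 M] (p : M) :
    (mfderiv 𝓘(ℝ, E) I (extChartAt I p).symm (extChartAt I p p) : E →L[ℝ] E) =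
      ContinuousLinearMap.id ℝ E := by
  have h := mfderivWithin_range_extChartAt_symm (I := I) (x := p)
  rw [I.range_eq_univ, mfderivWithin_univ] at h
  exact h

theorem MetricField.inChart_self [IsManifold I 1 M] (g : MetricField I M) (p : M) :
    (g.inChart p (extChartAt I p p) : E →L[ℝ] E →L[ℝ] ℝ) = g p := by
  rw [MetricField.inChart, mfderiv_extChartAt_symm_self]
  have : (extChartAt I p).symm (extChartAt I p p) = p := extChartAt_to_inv p
  refine ContinuousLinearMap.ext fun u => ContinuousLinearMap.ext fun v => ?_
  change (g ((extChartAt I p).symm (extChartAt I p p)) : E →L[ℝ] E →L[ℝ] ℝ) u v = _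
  rw [this]
  rfl

/-- In finite dimension a linear map is a tuple of values on a basis; regularity of a metric can
thus be tested on fixed vectors. -/
theorem contDiffAt_clm_apply_iff {W V : Type*} [NormedAddCommGroup W] [NormedSpace ℝ W]
    [NormedAddCommGroup V] [NormedSpace ℝ V] [FiniteDimensional ℝ E] {n : WithTop ℕ∞}
    {f : V → E →L[ℝ] W} {y : V} :
    ContDiffAt ℝ n f y ↔ ∀ u, ContDiffAt ℝ n (fun z => f z u) y := by
  refine ⟨fun h u => h.clm_apply contDiffAt_const, fun h => ?_⟩
  let d := Module.finrank ℝ E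
  have hd : d = Module.finrank ℝ (Fin d → ℝ) := (Module.finrank_fin_fun ℝ).symm
  let e₁ := ContinuousLinearEquiv.ofFinrankEq hd
  let e₂ := (e₁.arrowCongr (1 : W ≃L[ℝ] W)).trans (ContinuousLinearEquiv.piRing (Fin d))
  rw [← Function.id_comp f, ← e₂.symm_comp_self]
  exact e₂.symm.contDiff.contDiffAt.comp y (contDiffAt_pi.mpr fun i => h _)

theorem isInvertible_mfderiv_extChartAt_symm [IsManifold I 1 M] {p : M} {y : E}
    (hy : y ∈ (extChartAt I p).target) :
    (mfderiv 𝓘(ℝ, E) I (extChartAt I p).symm y : E →L[ℝ] E).IsInvertible := by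
  have h := isInvertible_mfderivWithin_extChartAt_symm (𝕜 := ℝ) hy
  rw [I.range_eq_univ, mfderivWithin_univ] at h
  exact h

theorem mdifferentiableAt_extChartAt_symm [IsManifold I 1 M] {p : M} {y : E}
    (hy : y ∈ (extChartAt I p).target) :
    MDifferentiableAt 𝓘(ℝ, E) I (extChartAt I p).symm y := by
  have h := mdifferentiableWithinAt_extChartAt_symm (𝕜 := ℝ) hy
  rwa [I.range_eq_univ, mdifferentiableWithinAt_univ] at h

theorem IsMetricNear.inChart [FiniteDimensional ℝ E] [IsManifold I ∞ M]
    (g : ContMDiffRiemannianMetric I ∞ E (fun x : M => TangentSpace I x)) (p : M) :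
    IsMetricNear (MetricField.inChart (I := I) g.inner p) (extChartAt I p p) where
  contDiffAt := by
    have : IsManifold I 1 M := IsManifold.of_le (n := ∞) (by simp)
    rw [contDiffAt_clm_apply_iff]
    intro u
    rw [contDiffAt_clm_apply_iff]
    intro v
    let e := trivializationAt E (TangentSpace I) p
    -- A constant coordinate vector `w` becomes a smooth local vector field through the
    -- trivialization at `p`; `hA` below identifies it with the image of `w` under the differential
    -- of the inverse chart.
    have hs (w : E) : ContMDiffAt I (I.prod 𝓘(ℝ, E)) 2
        (fun q : M => TotalSpace.mk' E q (e.symmL ℝ q w)) p := by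
      have h := e.contMDiffAt_symmL (𝕜 := ℝ) (IB := I) (n := 2) (x := p) (by simp [e])
      exact h.clm_bundle_apply (E₁ := Bundle.Trivial M E) (v := fun _ => w) 
        (contMDiffAt_totalSpace.2 ⟨contMDiffAt_id, contMDiffAt_const⟩)
    have hg := (g.contMDiff.of_le (m := 2) (WithTop.coe_le_coe.2 le_top)).contMDiffAt (x := p)
    have h : ContMDiffAt I 𝓘(ℝ, ℝ) 2
        (fun q : M => g.inner q (e.symmL ℝ q u) (e.symmL ℝ q v)) p :=
      (contMDiffAt_totalSpace.1 (hg.clm_bundle_apply₂ (F₃ := ℝ) (E₃ := Bundle.Trivial M ℝ)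
        (hs u) (hs v))).2
    have hx : ContMDiffAt 𝓘(ℝ, E) I 2 (extChartAt I p).symm (extChartAt I p p) :=
      (contMDiffOn_extChartAt_symm p).contMDiffAt (extChartAt_target_mem_nhds p)
    have hc := ContMDiffAt.comp_of_eq h hx (extChartAt_to_inv p)
    refine (contMDiffAt_iff_contDiffAt.1 hc).congr_of_eventuallyEq ?_
    filter_upwards [extChartAt_target_mem_nhds (I := I) p] with z hz
    have hz' : (extChartAt I p).symm z ∈ (chartAt H p).source := by
      rw [← extChartAt_source I]
      exact (extChartAt I p).map_target hz
    have hA := TangentBundle.symmL_trivializationAt (𝕜 := ℝ) (I := I) hz'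
    rw [I.range_eq_univ, mfderivWithin_univ, (extChartAt I p).right_inv hz] at hA
    simp only [Function.comp_apply]
    change _ = g.inner ((extChartAt I p).symm z)
      ((trivializationAt E (TangentSpace I) p).symmL ℝ ((extChartAt I p).symm z) u)
      ((trivializationAt E (TangentSpace I) p).symmL ℝ ((extChartAt I p).symm z) v)
    rw [hA]
    rfl
  symm := by
    refine Eventually.of_forall fun z u v => ?_
    exact g.symm _ _ _
  isInvertible := by
    have : IsManifold I 1 M := IsManifold.of_le (n := ∞) (by simp)
    filter_upwards [extChartAt_target_mem_nhds (I := I) p] with z hz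
    refine ContinuousLinearMap.isInvertible_of_nondegenerate _ fun u hu => ?_
    by_contra hne
    have hA := (isInvertible_mfderiv_extChartAt_symm hz).injective
    refine (g.pos ((extChartAt I p).symm z) (mfderiv 𝓘(ℝ, E) I (extChartAt I p).symm z u)
      ?_).ne' (hu u)
    intro h0
    exact hne (hA (h0.trans (map_zero (mfderiv 𝓘(ℝ, E) I (extChartAt I p).symm z)).symm))

end Charts

/-! ### Charts of generalized Robertson-Walker spacetimes -/

namespace GRWSpacetime

open Filter Topology

theorem extChartAt_opens_eq (U : TopologicalSpace.Opens ℝ) (t s : U) :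
    extChartAt 𝓘(ℝ, ℝ) t = extChartAt 𝓘(ℝ, ℝ) s := rfl

/-- All points of the open set share one chart, so the identity at the base point holds at every
point. In the fibre this fails away from the base point. -/
theorem mfderiv_extChartAt_opens_symm (U : TopologicalSpace.Opens ℝ) (t : U) {s : ℝ}
    (hs : s ∈ (extChartAt 𝓘(ℝ, ℝ) t).target) :
    (mfderiv 𝓘(ℝ, ℝ) 𝓘(ℝ, ℝ) (extChartAt 𝓘(ℝ, ℝ) t).symm s : ℝ →L[ℝ] ℝ) =
      ContinuousLinearMap.id ℝ ℝ := by
  have h := mfderiv_extChartAt_symm_self (I := 𝓘(ℝ, ℝ)) ((extChartAt 𝓘(ℝ, ℝ) t).symm s)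
  rw [extChartAt_opens_eq U _ t, (extChartAt 𝓘(ℝ, ℝ) t).right_inv hs] at h
  exact h

variable {m : ℕ} {N : Type*} [TopologicalSpace N] [ChartedSpace (EuclideanSpace ℝ (Fin m)) N]
  [IsManifold (𝓡 m) ∞ N]

theorem mfderiv_extChartAt_symm (S : GRWSpacetime m N) (p : S.Carrier)
    {y : ℝ × EuclideanSpace ℝ (Fin m)} (hy : y ∈ (extChartAt S.model p).target) :
    (mfderiv 𝓘(ℝ, ℝ × EuclideanSpace ℝ (Fin m)) S.model (extChartAt S.model p).symm y :
      ℝ × EuclideanSpace ℝ (Fin m) →L[ℝ] ℝ × EuclideanSpace ℝ (Fin m)) =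
    (ContinuousLinearMap.id ℝ ℝ).prodMap
      (mfderiv 𝓘(ℝ, EuclideanSpace ℝ (Fin m)) (𝓡 m) (extChartAt (𝓡 m) p.2).symm y.2 :
        EuclideanSpace ℝ (Fin m) →L[ℝ] EuclideanSpace ℝ (Fin m)) := by
  have he : extChartAt S.model p = (extChartAt 𝓘(ℝ, ℝ) p.1).prod (extChartAt (𝓡 m) p.2) :=
    extChartAt_prod p
  rw [he] at hy
  have h := mfderiv_prodMap (p := y)
    (mdifferentiableAt_extChartAt_symm (I := 𝓘(ℝ, ℝ)) hy.1)
    (mdifferentiableAt_extChartAt_symm (I := 𝓡 m) hy.2)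
  rw [he, modelWithCornersSelf_prod, ← chartedSpaceSelf_prod]
  refine Eq.trans h ?_
  rw [← mfderiv_extChartAt_opens_symm S.interval p.1 hy.1]
  rfl

theorem metric_inChart (S : GRWSpacetime m N) (p : S.Carrier) :
    S.metric.inChart p =ᶠ[𝓝 (extChartAt S.model p p)]
      warpedMetric S.scale (S.fibreField.inChart p.2) := by
  filter_upwards [extChartAt_target_mem_nhds (I := S.model) p] with y hy
  have he : extChartAt S.model p = (extChartAt 𝓘(ℝ, ℝ) p.1).prod (extChartAt (𝓡 m) p.2) :=
    extChartAt_prod p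
  rw [MetricField.inChart, mfderiv_extChartAt_symm S p hy]
  rw [he] at hy ⊢
  refine ContinuousLinearMap.ext fun u => ContinuousLinearMap.ext fun v => ?_
  rw [warpedMetric_apply]
  have hs : (((extChartAt 𝓘(ℝ, ℝ) p.1).symm y.1 : S.interval) : ℝ) = y.1 :=
    (extChartAt 𝓘(ℝ, ℝ) p.1).right_inv hy.1
  have := S.metric_apply ((extChartAt 𝓘(ℝ, ℝ) p.1).symm y.1, (extChartAt (𝓡 m) p.2).symm y.2)
    (u.1, mfderiv 𝓘(ℝ, EuclideanSpace ℝ (Fin m)) (𝓡 m) (extChartAt (𝓡 m) p.2).symm y.2 u.2)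
    (v.1, mfderiv 𝓘(ℝ, EuclideanSpace ℝ (Fin m)) (𝓡 m) (extChartAt (𝓡 m) p.2).symm y.2 v.2)
  rw [hs] at this
  exact this

end GRWSpacetime

/-! ### Solitons with constant derivative along `ρ` -/

namespace GRWSpacetime

open Filter Topology

variable {m : ℕ} {N : Type*} [TopologicalSpace N] [ChartedSpace (EuclideanSpace ℝ (Fin m)) N]
  [IsManifold (𝓡 m) ∞ N] {S : GRWSpacetime m N} {f : S.Carrier → ℝ} {lam c : ℝ}

theorem exists_deriv_scale_ne_zero (S : GRWSpacetime m N)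
    (hS : ∃ s ∈ S.interval, ∃ t ∈ S.interval, S.scale s ≠ S.scale t) :
    ∃ t : S.interval, deriv S.scale t ≠ 0 := by
  by_contra! h
  obtain ⟨s, hs, t, ht, hst⟩ := hS
  exact hst (S.interval.isOpen.is_const_of_deriv_eq_zero S.isConnected_interval.isPreconnected
    (S.contDiffOn_scale.differentiableOn (by simp)) (fun x hx => h ⟨x, hx⟩) hs ht)

theorem contDiffAt_scale (S : GRWSpacetime m N) (t : S.interval) : ContDiffAt ℝ 2 S.scale t :=
  (S.contDiffOn_scale.contDiffAt (S.interval.isOpen.mem_nhds t.2)).of_le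
    (WithTop.coe_le_coe.2 le_top)

theorem extChartAt_self_eq (S : GRWSpacetime m N) (p : S.Carrier) :
    extChartAt S.model p p = ((p.1 : ℝ), extChartAt (𝓡 m) p.2 p.2) := by
  have he : extChartAt S.model p = (extChartAt 𝓘(ℝ, ℝ) p.1).prod (extChartAt (𝓡 m) p.2) :=
    extChartAt_prod p
  rw [he]
  rfl

theorem fibreField_isMetricNear (S : GRWSpacetime m N) (x : N) :
    IsMetricNear (S.fibreField.inChart x) (extChartAt (𝓡 m) x x) :=
  IsMetricNear.inChart S.fibreMetric x

/-- The differential of `f`, as a linear form on `ℝ × ℝᵐ`. -/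
noncomputable def differential (S : GRWSpacetime m N) (f : S.Carrier → ℝ) (p : S.Carrier) :
    ℝ × EuclideanSpace ℝ (Fin m) →L[ℝ] ℝ :=
  mfderiv S.model 𝓘(ℝ, ℝ) f p

/-- The differential of the inverse of the preferred chart of the fibre at `x`. -/
noncomputable def fibreChartDeriv (x : N) (z : EuclideanSpace ℝ (Fin m)) :
    EuclideanSpace ℝ (Fin m) →L[ℝ] EuclideanSpace ℝ (Fin m) :=
  mfderiv 𝓘(ℝ, EuclideanSpace ℝ (Fin m)) (𝓡 m) (extChartAt (𝓡 m) x).symm z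

theorem fderiv_comp_chart (hf : ContMDiff S.model 𝓘(ℝ, ℝ) ∞ f) (p : S.Carrier)
    {y : ℝ × EuclideanSpace ℝ (Fin m)} (hy : y ∈ (extChartAt S.model p).target)
    (w : ℝ × EuclideanSpace ℝ (Fin m)) :
    fderiv ℝ (f ∘ (extChartAt S.model p).symm) y w =
      S.differential f ((extChartAt S.model p).symm y) (w.1, fibreChartDeriv p.2 y.2 w.2) := by
  have h := mfderiv_comp y (hf.mdifferentiable (by simp) _)
    (mdifferentiableAt_extChartAt_symm hy)
  have h' := congrArg (fun L : ℝ × EuclideanSpace ℝ (Fin m) →L[ℝ] ℝ => L w)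
    ((mfderiv_eq_fderiv (f := f ∘ (extChartAt S.model p).symm)).symm.trans h)
  refine h'.trans ?_
  have h₂ := congrArg (fun L : ℝ × EuclideanSpace ℝ (Fin m) →L[ℝ] ℝ × EuclideanSpace ℝ (Fin m) =>
    S.differential f ((extChartAt S.model p).symm y) (L w)) (mfderiv_extChartAt_symm S p hy)
  exact h₂

theorem contDiffAt_comp_chart (hf : ContMDiff S.model 𝓘(ℝ, ℝ) ∞ f) (p : S.Carrier) :
    ContDiffAt ℝ ∞ (f ∘ (extChartAt S.model p).symm) (extChartAt S.model p p) :=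
  contMDiffAt_iff_contDiffAt.1 (ContMDiffAt.comp _ hf.contMDiffAt
    ((contMDiffOn_extChartAt_symm p).contMDiffAt (extChartAt_target_mem_nhds p)))

theorem differentiableAt_fderiv_comp_chart (hf : ContMDiff S.model 𝓘(ℝ, ℝ) ∞ f) (p : S.Carrier) :
    DifferentiableAt ℝ (fderiv ℝ (f ∘ (extChartAt S.model p).symm)) (extChartAt S.model p p) :=
  (((contDiffAt_comp_chart hf p).of_le (m := 2) (WithTop.coe_le_coe.2 le_top)).fderiv_right
    (m := 1) (by norm_num)).differentiableAt (by norm_num)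

theorem _root_.fderiv_fderiv_apply_eq_zero {E : Type*} [NormedAddCommGroup E] [NormedSpace ℝ E]
    {φ : E → ℝ} {y : E} (hφ : DifferentiableAt ℝ (fderiv ℝ φ) y) {v : E} {a : ℝ}
    (h : ∀ᶠ z in 𝓝 y, fderiv ℝ φ z v = a) (u : E) : fderiv ℝ (fderiv ℝ φ) y u v = 0 := by
  have h₁ := (hφ.hasFDerivAt.clm_apply (hasFDerivAt_const v y)).unique
    ((hasFDerivAt_const a y).congr_of_eventuallyEq h)
  simpa using congrArg (fun L : E →L[ℝ] ℝ => L u) h₁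

/-- The mixed soliton equation reduces to `(F'/F) df(v) = 0`. -/
theorem mfderiv_fibre_eq_zero (hsol : S.metric.IsGradientRicciSoliton f lam)
    (hc : ∀ p : S.Carrier, S.rhoDeriv f p = c) (p : S.Carrier) (hp : deriv S.scale p.1 ≠ 0)
    (v : EuclideanSpace ℝ (Fin m)) :
    S.differential f p (0, v) = 0 := by
  have hs := S.scale_pos p.1 p.1.2
  have h : localHessian (S.metric.inChart p) (f ∘ (extChartAt S.model p).symm)
        (extChartAt S.model p p) (0, v) (1, 0)
      + localRicci (S.metric.inChart p) (extChartAt S.model p p) (0, v) (1, 0)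
      + lam * S.metric p ((0 : ℝ), v) ((1 : ℝ), (0 : EuclideanSpace ℝ (Fin m))) = 0 :=
    hsol.soliton p _ _
  -- In the chart `∂_t f` is the constant `c` near the point, so its derivative along `v` vanishes.
  have hD : fderiv ℝ (fderiv ℝ (f ∘ (extChartAt S.model p).symm)) (extChartAt S.model p p)
      (0, v) (1, 0) = 0 := by
    refine fderiv_fderiv_apply_eq_zero (a := c) (differentiableAt_fderiv_comp_chart hsol.smooth p)
      ?_ _
    filter_upwards [extChartAt_target_mem_nhds (I := S.model) p] with y hy
    rw [fderiv_comp_chart hsol.smooth p hy, map_zero]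
    exact hc _
  have hD₁ (w : ℝ × EuclideanSpace ℝ (Fin m)) :
      fderiv ℝ (f ∘ (extChartAt S.model p).symm) (extChartAt S.model p p) w =
        S.differential f p w := by
    have hA : fibreChartDeriv p.2 (extChartAt S.model p p).2 = ContinuousLinearMap.id ℝ _ := by
      rw [extChartAt_self_eq]
      exact mfderiv_extChartAt_symm_self p.2
    rw [fderiv_comp_chart hsol.smooth p (mem_extChartAt_target p), hA, extChartAt_to_inv]
    rfl
  rw [S.metric_apply, localRicci_congr (S.metric_inChart p),
    localHessian_congr (S.metric_inChart p),
    localHessian, hD, hD₁, extChartAt_self_eq,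
    localRicci_warpedMetric_mixed (S.fibreField_isMetricNear p.2) (S.contDiffAt_scale p.1) hs.ne',
    christoffel_warpedMetric (S.fibreField_isMetricNear p.2) (S.contDiffAt_scale p.1) hs.ne'] at h
  have e : ((0 : ℝ), (deriv S.scale p.1 / S.scale p.1) • v) =
    (deriv S.scale p.1 / S.scale p.1) • ((0 : ℝ), v) := by simp
  have h₀ : S.fibreMetric.inner p.2 v (0 : EuclideanSpace ℝ (Fin m)) = 0 := map_zero _
  simp only [mul_zero, zero_mul, neg_zero, zero_add, h₀, add_zero, map_zero, zero_smul, one_smul,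
    zero_sub] at h
  rw [e, map_smul, smul_eq_mul, neg_eq_zero] at h
  exact (mul_eq_zero.1 h).resolve_left (div_ne_zero hp hs.ne')

/-- Where `F' ≠ 0`, the soliton equation says that the fibre is an Einstein manifold. -/
theorem ricci_fibre_eq (hsol : S.metric.IsGradientRicciSoliton f lam)
    (hc : ∀ p : S.Carrier, S.rhoDeriv f p = c) (t : S.interval) (ht : deriv S.scale t ≠ 0) (x : N)
    (v w : EuclideanSpace ℝ (Fin m)) :
    localRicci (S.fibreField.inChart x) (extChartAt (𝓡 m) x x) v w =
      (c * (S.scale t * deriv S.scale t) - S.scale t * deriv (deriv S.scale) t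
        - (m - 1) * deriv S.scale t ^ 2 - lam * S.scale t ^ 2)
      * S.fibreField.inChart x (extChartAt (𝓡 m) x x) v w := by
  have hs := S.scale_pos t t.2
  obtain ⟨p, hp⟩ : ∃ p : S.Carrier, p = (t, x) := ⟨_, rfl⟩
  have hp₁ : p.1 = t := by rw [hp]
  have hp₂ : p.2 = x := by rw [hp]
  have h : localHessian (S.metric.inChart p) (f ∘ (extChartAt S.model p).symm)
        (extChartAt S.model p p) (0, v) (0, w)
      + localRicci (S.metric.inChart p) (extChartAt S.model p p) (0, v) (0, w)
      + lam * S.metric p ((0 : ℝ), v) ((0 : ℝ), w) = 0 :=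
    hsol.soliton p _ _
  -- `F' ≠ 0` persists near `t`, so `df = c dt` holds on a neighbourhood and can be differentiated.
  have hD : ∀ᶠ y in 𝓝 (extChartAt S.model p p), ∀ w,
      fderiv ℝ (f ∘ (extChartAt S.model p).symm) y w = c * w.1 := by
    have hF : ∀ᶠ s in 𝓝 (t : ℝ), deriv S.scale s ≠ 0 := by
      have h₁ : ContinuousAt (fderiv ℝ S.scale) t :=
        ((S.contDiffAt_scale t).fderiv_right (m := 1) (by norm_num)).continuousAt
      exact (h₁.clm_apply continuousAt_const).eventually_ne ht
    have hF' : ∀ᶠ y in 𝓝 (extChartAt S.model p p), deriv S.scale y.1 ≠ 0 := by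
      rw [extChartAt_self_eq, hp₁]
      exact (continuous_fst.tendsto ((t : ℝ), extChartAt (𝓡 m) p.2 p.2)).eventually hF
    filter_upwards [extChartAt_target_mem_nhds (I := S.model) p, hF'] with y hy hy' w
    rw [fderiv_comp_chart hsol.smooth p hy]
    have hy₁ : ((((extChartAt S.model p).symm y).1 : S.interval) : ℝ) = y.1 :=
      congrArg Prod.fst ((extChartAt S.model p).right_inv hy)
    have h₀ := mfderiv_fibre_eq_zero hsol hc ((extChartAt S.model p).symm y) (by rwa [hy₁])
    have h₁ : S.differential f ((extChartAt S.model p).symm y) (1, 0) = c := hc _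
    have e (a : ℝ) (u : EuclideanSpace ℝ (Fin m)) : (a, u) = a • ((1 : ℝ), 0) + (0, u) := by simp
    rw [e w.1, map_add, map_smul, h₀, h₁, add_zero, smul_eq_mul, mul_comm]
  have hD₂ : fderiv ℝ (fderiv ℝ (f ∘ (extChartAt S.model p).symm)) (extChartAt S.model p p)
      (0, v) (0, w) = 0 := by
    refine fderiv_fderiv_apply_eq_zero (a := 0) (differentiableAt_fderiv_comp_chart hsol.smooth p)
      ?_ _
    filter_upwards [hD] with y hy
    rw [hy, mul_zero]
  have hself := S.fibreField.inChart_self x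
  rw [S.metric_apply, localRicci_congr (S.metric_inChart p),
    localHessian_congr (S.metric_inChart p),
    localHessian, hD₂, hD.self_of_nhds, extChartAt_self_eq,
    localRicci_warpedMetric (S.fibreField_isMetricNear p.2) (S.contDiffAt_scale p.1)
      (hp₁ ▸ hs.ne'),
    christoffel_warpedMetric (S.fibreField_isMetricNear p.2) (S.contDiffAt_scale p.1)
      (hp₁ ▸ hs.ne')] at h
  rw [hp₁, hp₂] at h
  have hg : S.fibreMetric.inner x v w = S.fibreField.inChart x (extChartAt (𝓡 m) x x) v w := by
    rw [hself]; rfl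
  simp only [hg, finrank_euclideanSpace, Fintype.card_fin, mul_zero, neg_zero, zero_add, zero_sub]
    at h
  linear_combination h

end GRWSpacetime

theorem mainTheorem3 {N : Type*} [TopologicalSpace N]
    [ChartedSpace (EuclideanSpace ℝ (Fin 3)) N] [IsManifold (𝓡 3) ∞ N]
    (S : GRWSpacetime 3 N)
    (hS : ∃ s ∈ S.interval, ∃ t ∈ S.interval, S.scale s ≠ S.scale t)
    (f : S.Carrier → ℝ) (lam : ℝ)
    (hsol : S.metric.IsGradientRicciSoliton f lam)
    (c : ℝ) (hc : ∀ p : S.Carrier, S.rhoDeriv f p = c) :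
    S.IsRobertsonWalker := by
  obtain ⟨t, ht⟩ := S.exists_deriv_scale_ne_zero hS
  -- The time `t` is fixed before `x` varies, which makes `μ` the same at all points of the fibre.
  obtain ⟨μ, hμ⟩ : ∃ μ : ℝ, ∀ (x : N) (v w : EuclideanSpace ℝ (Fin 3)),
      localRicci (S.fibreField.inChart x) (extChartAt (𝓡 3) x x) v w =
        μ * S.fibreField.inChart x (extChartAt (𝓡 3) x x) v w :=
    ⟨_, GRWSpacetime.ricci_fibre_eq hsol hc t ht⟩
  refine ⟨μ / 2, fun x u v huv => ?_⟩
  have hself := S.fibreField.inChart_self x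
  have h := (S.fibreField_isMetricNear x).sectional_of_einstein (by simp)
    (fun u hu => by rw [hself]; exact S.fibreMetric.pos x u hu)
    (hμ x) u v (by rw [hself]; exact huv)
  rw [hself] at h
  exact h
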